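/- \textbf{Theorem (Reversed Reflection Diamond Principle).} Let $\mathbb{F}$ be a field and let $\mathcal{Q}$ be a quiver of type $A_n$, with vertices $1,\dots,n$ and, for each $1\le k<n$, one arrow between $k$ and $k+1$, either forward ($k\to k+1$) or backward ($k\leftarrow k+1$). A zigzag module is a representation of $\mathcal{Q}$ over $\mathbb{F}$; for $b\le d$, $\mathbb{I}[b;d]$ is the interval module with $\mathbb{F}$ at the vertices $b,\dots,d$, $0$ elsewhere, identity maps inside the interval and zero maps elsewhere. For $j<k$ put $j\le_b k$ if the arrow between $k-1$ and $k$ is forward and $k\le_b j$ if it is backward; put $j\le_d k$ if the arrow between $j$ and $j+1$ is forward and $k\le_d j$ if it is backward. These are total orders. Let $1<i<n$ and let both arrows at $i$ point away from $i$. Let $\mathbb{V}$ be a zigzag module with the same space $V$ at $i-1,i,i+1$ and with identity maps $V\to V$ on the arrows $i\to i-1$ and $i\to i+1$. Let $g:W\to V$ be a linear map, and let $\mathbb{W}$ be obtained from $\mathbb{V}$ by putting $W$ at $i$ instead of $V$ and $g$ on both arrows $i\to i-1$, $i\to i+1$, everything else being unchanged. \emph{1.} If $g$ is surjective of nullity $1$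 (i.e. $\dim\ker g=1$), then $\mathbb{W}\cong\mathbb{V}\oplus\mathbb{I}[i;i]$. \emph{2.} Suppose that $g$ is injective of corank $1$ (i.e. $\dim V/\mathrm{im}\,g=1$). Let $\{v_1,\dots,v_e\}$ be a basis of the space $V$ at vertex $i$ that is compatible with a decomposition of $\mathbb{V}$ as a finite direct sum of interval submodules, i.e. every $v_j$ is the component at vertex $i$ of a family of vectors, one at each vertex, that spans one of the summands; let $\mathbb{I}[b_j;d_j]$ be the isomorphism type of that summand. Let $\langle\cdot,\cdot\rangle$ be the bilinear form on $V$ with $\langle v_j,v_k\rangle=\delta_{jk}$, and let $\xi\neq0$ generate $(\mathrm{im}\,g)^\perp$. Number the basis such that $\xi=a_1v_1+\dots+a_pv_p$ with $a_j\ne0$ for $1\le j\le p$ and $d_1\ge_d\dots\ge_d d_p$. Then $b_j\le i-1$ and $d_j\ge i+1$ for $1\le j\le p$. Choose an index $\ell_p$ such that $b_{\ell_p}=\min_{\le_b}\{b_1,\dots,b_p\}$ and regard the index $\ell_p$ as already paired. For $j=1,\dots,p-1$ in this order: if the index $j$ is not yet paired, put $\ell_j=j$; otherwise choose $\ell_j$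 among the indices $k\in\{1,\dots,p\}$ not yet paired such that $b_{\ell_j}$ is minimal for $\le_b$; then regard $\ell_j$ as paired. This rule can always be carried out, and for every way of carrying it out (ties between equal births being broken arbitrarily) there is a zigzag module $\mathbb{X}$ with \[ \mathbb{V}\cong\mathbb{X}\oplus\bigoplus_{j=1}^{p}\mathbb{I}[b_j;d_j],\qquad \mathbb{W}\cong\mathbb{X}\oplus\mathbb{I}[b_{\ell_p};i-1]\oplus\mathbb{I}[i+1;d_p]\oplus\bigoplus_{j=1}^{p-1}\mathbb{I}[b_{\ell_j};d_j]. \] (Here $d_p=\min_{\le_d}\{d_1,\dots,d_p\}$.) -/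

import Mathlib

universe u v w

/-- The arrows of a quiver of type `A_n` with vertices `Fin n` (vertex `k` is the vertex number
`k + 1` of the usual numbering `1, …, n`). `o k = true` means that the arrow between `k` and `k + 1`
is forward, `k → k + 1`, and `o k = false` that it is backward, `k ← k + 1`; the value of `o` at
the last vertex plays no role. `ZigzagArrow o i j` says that there is an arrow from `i` to `j`. -/
def ZigzagArrow {n : ℕ} (o : Fin n → Bool) (i j : Fin n) : Prop :=
  (i.val + 1 = j.val ∧ o i = true) ∨ (j.val + 1 = i.val ∧ o j = false)

/-- The birth order: for `i < j`, `i ≤_b j` if the arrow between `j - 1` and `j` is forward, and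
`j ≤_b i` if it is backward. -/
def birthLE {n : ℕ} (o : Fin n → Bool) (i j : Fin n) : Prop :=
  i = j ∨ (i < j ∧ ∃ k : Fin n, k.val + 1 = j.val ∧ ZigzagArrow o k j) ∨
    (j < i ∧ ∃ k : Fin n, k.val + 1 = i.val ∧ ZigzagArrow o i k)

/-- The death order: for `i < j`, `i ≤_d j` if the arrow between `i` and `i + 1` is forward, and
`j ≤_d i` if it is backward. -/
def deathLE {n : ℕ} (o : Fin n → Bool) (i j : Fin n) : Prop :=
  i = j ∨ (i < j ∧ ∃ k : Fin n, i.val + 1 = k.val ∧ ZigzagArrow o i k) ∨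
    (j < i ∧ ∃ k : Fin n, j.val + 1 = k.val ∧ ZigzagArrow o k j)

/-- A zigzag module: a representation over `F` of the `A_n` quiver with orientation `o`. -/
structure ZigzagModule (F : Type u) [Field F] {n : ℕ} (o : Fin n → Bool) where
  V : Fin n → Type v
  [addCommGroup : ∀ k, AddCommGroup (V k)]
  [module : ∀ k, Module F (V k)]
  map : ∀ {i j : Fin n}, ZigzagArrow o i j → (V i →ₗ[F] V j)

attribute [instance] ZigzagModule.addCommGroup ZigzagModule.module

namespace ZigzagModule

section

variable {F : Type u} [Field F] {n : ℕ} {o : Fin n → Bool}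

/-- Isomorphisms of zigzag modules over the same quiver. -/
structure Iso (M : ZigzagModule.{u, v} F o) (N : ZigzagModule.{u, w} F o) where
  equiv : ∀ k, M.V k ≃ₗ[F] N.V k
  comm : ∀ {i j : Fin n} (a : ZigzagArrow o i j) (x : M.V i),
    equiv j (M.map a x) = N.map a (equiv i x)

/-- The direct sum of two zigzag modules. -/
def prod (M : ZigzagModule.{u, v} F o) (N : ZigzagModule.{u, w} F o) :
    ZigzagModule.{u, max v w} F o where
  V k := M.V k × N.V k
  map a := (M.map a).prodMap (N.map a)

/-- The direct sum of a finite list of zigzag modules (the zero module for the empty list). -/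
def finSum {q : ℕ} (M : Fin q → ZigzagModule.{u, v} F o) : ZigzagModule.{u, v} F o where
  V k := ∀ t, (M t).V k
  map a := LinearMap.piMap fun t => (M t).map a

open Classical in
/-- The interval module `𝕀[b; d]`: a copy of `F` (functions from a one-point type to `F`) at every
vertex `k` with `b ≤ k ≤ d`, zero (functions from an empty type) at every other vertex, identity
maps inside the interval and zero maps elsewhere. -/
noncomputable def interval (F : Type u) [Field F] {n : ℕ} (o : Fin n → Bool) (b d : Fin n) :
    ZigzagModule.{u, u} F o where
  V k := PLift (b ≤ k ∧ k ≤ d) → F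
  map {i _} _ :=
    { toFun := fun f _ => if h : b ≤ i ∧ i ≤ d then f ⟨h⟩ else 0
      map_add' := by intro f g; funext _; by_cases h : b ≤ i ∧ i ≤ d <;> simp [h]
      map_smul' := by intro c f; funext _; by_cases h : b ≤ i ∧ i ≤ d <;> simp [h] }

/-- A representative sequence spanning a copy of `𝕀[b; d]`: one vector per vertex, nonzero exactly
on `b, …, d`, such that every arrow that starts inside `b, …, d` maps its vector to the
vector at its target. (An arrow that enters the interval from outside maps zero to zero, as it does
in `𝕀[b; d]`.) -/
structure IsRepresentativeSequence (M : ZigzagModule.{u, v} F o) (x : ∀ k, M.V k)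
    (b d : Fin n) : Prop where
  ne_zero_iff : ∀ k, x k ≠ 0 ↔ b ≤ k ∧ k ≤ d
  map_eq : ∀ {i j : Fin n} (a : ZigzagArrow o i j), b ≤ i → i ≤ d → M.map a (x i) = x j

/-- A decomposition of `M` as a finite (internal) direct sum of interval submodules, the summand
number `t` being the copy of `𝕀[birth t; death t]` spanned by a representative sequence `seq t`. -/
structure IntervalDecomposition (M : ZigzagModule.{u, v} F o) where
  ι : Type
  [fintype : Fintype ι]
  birth : ι → Fin n
  death : ι → Fin n
  birth_le_death : ∀ t, birth t ≤ death t
  seq : ι → ∀ k, M.V k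
  isRep : ∀ t, M.IsRepresentativeSequence (seq t) (birth t) (death t)
  independent : ∀ k, iSupIndep fun t => Submodule.span F {seq t k}
  iSup_eq_top : ∀ k, (⨆ t, Submodule.span F {seq t k}) = ⊤

/-- The basis `v` of `M.V k` is compatible with the decomposition `D`, with `v j` attached to the
summand `att j`: every `v j` has a representative sequence that spans the summand `att j`. -/
def IsCompatibleBasis {M : ZigzagModule.{u, v} F o} (D : M.IntervalDecomposition) {k : Fin n}
    {e : ℕ} (v : Module.Basis (Fin e) F (M.V k)) (att : Fin e → D.ι) : Prop :=
  ∀ j, ∃ x : ∀ k, M.V k,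
    M.IsRepresentativeSequence x (D.birth (att j)) (D.death (att j)) ∧ x k = v j ∧
      ∀ k', Submodule.span F {x k'} = Submodule.span F {D.seq (att j) k'}

/-- A reversed reflection diamond at the vertex `m` with neighbours `l = m - 1` and `r = m + 1`,
both arrows at `m` pointing away from `m`. In the bottom module `𝕍` the spaces at `l`, `m`, `r` are
three copies of one space `V`, identified by the maps `m → l` and `m → r` (the identity of `V`).
The top module `𝕎` has the same spaces (up to given identifications `φ`) and the same maps as `𝕍`
away from `m`; its space `W` at `m` comes with a map `g : W → V`, and its maps `m → l` and `m → r`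
are `g`, followed by the identifications of the copies of `V`. -/
structure ReversedReflectionDiamond (𝕍 : ZigzagModule.{u, v} F o) (𝕎 : ZigzagModule.{u, w} F o)
    (l m r : Fin n) where
  left_eq : l.val + 1 = m.val
  right_eq : m.val + 1 = r.val
  arrow_left : ZigzagArrow o m l
  arrow_right : ZigzagArrow o m r
  bijective_left : Function.Bijective (𝕍.map arrow_left)
  bijective_right : Function.Bijective (𝕍.map arrow_right)
  φ : ∀ k, k ≠ m → (𝕎.V k ≃ₗ[F] 𝕍.V k)
  φ_comm : ∀ {i j : Fin n} (a : ZigzagArrow o i j) (hi : i ≠ m) (hj : j ≠ m) (x : 𝕎.V i),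
    φ j hj (𝕎.map a x) = 𝕍.map a (φ i hi x)
  g : 𝕎.V m →ₗ[F] 𝕍.V m
  comm_left : ∀ (hl : l ≠ m) (x : 𝕎.V m),
    φ l hl (𝕎.map arrow_left x) = 𝕍.map arrow_left (g x)
  comm_right : ∀ (hr : r ≠ m) (x : 𝕎.V m),
    φ r hr (𝕎.map arrow_right x) = 𝕍.map arrow_right (g x)

end

end ZigzagModule

/-- At the start of step `j` of the greedy rule, the birth number `k` is not yet paired: it is
neither the birth `ℓ_p`, set aside at the beginning, nor one of the births `ℓ_1, …, ℓ_{j-1}` that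
were paired before. The indices `1, …, p` are those of `Fin (q + 1)`, with `p = q + 1`. -/
def NotYetPaired {q : ℕ} (ℓ : Fin (q + 1) → Fin (q + 1)) (j k : Fin (q + 1)) : Prop :=
  k ≠ ℓ (Fin.last q) ∧ ∀ i < j, k ≠ ℓ i

/-- `ℓ` is a result of the greedy rule for the births `b`, compared by `le`. The birth `ℓ_p` is
minimal among all births. For `j = 1, …, p - 1` in this order, if the birth number `j` is
not yet paired, then `ℓ_j = j`; otherwise `ℓ_j` is a minimal birth among those not yet paired. -/
structure IsGreedyPairing {n q : ℕ} (le : Fin n → Fin n → Prop) (b : Fin (q + 1) → Fin n)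
    (ℓ : Fin (q + 1) → Fin (q + 1)) : Prop where
  last : ∀ k, le (b (ℓ (Fin.last q))) (b k)
  keep : ∀ j < Fin.last q, NotYetPaired ℓ j j → ℓ j = j
  choose_min : ∀ j < Fin.last q, ¬ NotYetPaired ℓ j j →
    NotYetPaired ℓ j (ℓ j) ∧ ∀ k, NotYetPaired ℓ j k → le (b (ℓ j)) (b k)

/-!
A reversed reflection diamond is a morphism `G : 𝕎 → 𝕍` that is bijective away from the vertex `m`
and equal to `g` there (`ReversedReflectionDiamond.exists_hom`). If `g` is surjective, the kernel of
`G` is a module concentrated at the source `m`, and it splits off.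

If `g` is injective of corank one, `𝕎` is the submodule of `𝕍` given by the kernel of a linear
form `α` at `m`, where `α` takes the nonzero value `a_j` at the generator `x_j` of the `j`-th
interval occurring in `ξ` and vanishes on the other generators. By `nonempty_iso_pi_interval` it
suffices to find images of interval modules in `𝕍` whose nonzero vectors form a basis of `𝕎` at
every vertex. The generators that do not occur in `ξ` are kept. The generator of the minimal birth
`ℓ_p` is truncated to the left of `m`, and that of the minimal death to the right of `m`. The
remaining ones come from the bookkeeping of the greedy rule: at step `j` a single birth `c_j`, the
pivot, is paired in addition to those before `j`; it precedes all births not yet paired, and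
`{c_j, ℓ_j}` consists of `j` and a larger index (`IsGreedyPairing.exists_pivot_of_castSucc`). The vector
`a_{c_j} x_{ℓ_j} - a_{ℓ_j} x_{c_j}` lies in the kernel of `α`. Since `b_{c_j} ≤_b b_{ℓ_j}` and both
deaths are at most `d_j` for `≤_d`, its truncation to `[b_{ℓ_j}, d_j]` is the image of an interval
module (`IsIntervalHom.truncate`). To the left of `m` these vectors are triangular with leading
terms `x_{ℓ_j}`, because `c_j` is paired before `ℓ_j`; to the right of `m` they are triangular with
leading terms `x_j`, because the other index is larger. So they form bases on both sides
(`linearIndepOn_and_span_eq_of_two_term`), and at `m` the left-hand basis without `x_{ℓ_p}` spans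
the kernel of `α`.
-/

/-- There is only one arrow between two vertices. -/
theorem ZigzagArrow.not_symm {n : ℕ} {o : Fin n → Bool} {i j : Fin n} (h : ZigzagArrow o i j) :
    ¬ ZigzagArrow o j i := by
  rintro (⟨h', h''⟩ | ⟨h', h''⟩) <;> rcases h with ⟨h, h₁⟩ | ⟨h, h₁⟩ <;>
    first | omega | simp_all

/-! ### Morphisms, isomorphisms and direct sums -/

namespace ZigzagModule

variable {F : Type u} [Field F] {n : ℕ} {o : Fin n → Bool}

/-- Morphisms of zigzag modules over the same quiver. -/
structure Hom (M : ZigzagModule.{u, v} F o) (N : ZigzagModule.{u, w} F o) where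
  app : ∀ k, M.V k →ₗ[F] N.V k
  comm : ∀ {i j : Fin n} (a : ZigzagArrow o i j) (x : M.V i),
    app j (M.map a x) = N.map a (app i x)

universe v₁ v₂ v₃ v₄

namespace Iso

/-- The inverse isomorphism. -/
def symm {M : ZigzagModule.{u, v₁} F o} {N : ZigzagModule.{u, v₂} F o} (e : Iso M N) :
    Iso N M where
  equiv k := (e.equiv k).symm
  comm a x := by
    rw [LinearEquiv.symm_apply_eq, e.comm, LinearEquiv.apply_symm_apply]

/-- The composite of two isomorphisms. -/
def trans {M : ZigzagModule.{u, v₁} F o} {N : ZigzagModule.{u, v₂} F o}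
    {P : ZigzagModule.{u, v₃} F o} (e : Iso M N) (f : Iso N P) : Iso M P where
  equiv k := (e.equiv k).trans (f.equiv k)
  comm a x := by simp [e.comm, f.comm]

/-- The identity isomorphism. -/
def refl (M : ZigzagModule.{u, v₁} F o) : Iso M M where
  equiv _ := LinearEquiv.refl F _
  comm _ _ := rfl

/-- The direct sum of two isomorphisms. -/
def prodCongr {M : ZigzagModule.{u, v₁} F o} {M' : ZigzagModule.{u, v₂} F o}
    {N : ZigzagModule.{u, v₃} F o} {N' : ZigzagModule.{u, v₄} F o} (e : Iso M M')
    (f : Iso N N') : Iso (M.prod N) (M'.prod N') where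
  equiv k := (e.equiv k).prodCongr (f.equiv k)
  comm a x := Prod.ext (e.comm a x.1) (f.comm a x.2)

end Iso

/-- The direct sum of a family of zigzag modules indexed by a type `ι` (meant to be finite); for
`ι = Fin q` it is `finSum`. -/
def pi {ι : Type} (M : ι → ZigzagModule.{u, v} F o) : ZigzagModule.{u, v} F o where
  V k := ∀ t, (M t).V k
  map a := LinearMap.piMap fun t => (M t).map a

/-- A direct sum over a disjoint union is the direct sum of two direct sums. -/
def piSumIso {ι κ : Type} (M : ι ⊕ κ → ZigzagModule.{u, v} F o) :
    Iso (pi M) ((pi fun t => M (.inl t)).prod (pi fun t => M (.inr t))) where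
  equiv k := LinearEquiv.sumPiEquivProdPi F ι κ fun t => (M t).V k
  comm _ _ := rfl

/-- A direct sum over a one-point type is its only summand. -/
def piUnitIso (M : Unit → ZigzagModule.{u, v} F o) : Iso (pi M) (M ()) where
  equiv k := LinearEquiv.piUnique F fun t => (M t).V k
  comm _ _ := rfl

/-- Two zigzag modules that embed into a third one with the same image are isomorphic. -/
theorem nonempty_iso_of_range_eq {N : ZigzagModule.{u, v₁} F o}
    {P : ZigzagModule.{u, v₂} F o}
    {M : ZigzagModule.{u, v₃} F o} (G : Hom N M) (H : Hom P M)
    (hG : ∀ k, Function.Injective (G.app k)) (hH : ∀ k, Function.Injective (H.app k))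
    (h : ∀ k, LinearMap.range (G.app k) = LinearMap.range (H.app k)) : Nonempty (Iso N P) := by
  let e : ∀ k, N.V k ≃ₗ[F] P.V k := fun k =>
    (LinearEquiv.ofInjective (G.app k) (hG k)).trans
      ((LinearEquiv.ofEq _ _ (h k)).trans (LinearEquiv.ofInjective (H.app k) (hH k)).symm)
  have he : ∀ k x, H.app k (e k x) = G.app k x := by
    intro k x
    have : LinearEquiv.ofInjective (H.app k) (hH k) (e k x) =
        LinearEquiv.ofEq _ _ (h k) (LinearEquiv.ofInjective (G.app k) (hG k) x) := by
      simp [e]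
    simpa using congrArg Subtype.val this
  refine ⟨⟨e, fun {i j} a x => hH j ?_⟩⟩
  rw [he, G.comm, H.comm, he]

/-! ### Images of interval modules -/

/-- A family of vectors, one per vertex, that is the image of the canonical generators of
`𝕀[b; d]` under a morphism from `𝕀[b; d]` to `M`: it vanishes off `b, …, d`, and every arrow that
starts in `b, …, d` maps its vector to the vector at its target. -/
structure IsIntervalHom (M : ZigzagModule.{u, v} F o) (x : ∀ k, M.V k) (b d : Fin n) : Prop where
  eq_zero : ∀ k, ¬ (b ≤ k ∧ k ≤ d) → x k = 0
  map_eq : ∀ {i j : Fin n} (a : ZigzagArrow o i j), b ≤ i → i ≤ d → M.map a (x i) = x j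

theorem IsRepresentativeSequence.isIntervalHom {M : ZigzagModule.{u, v} F o} {x : ∀ k, M.V k}
    {b d : Fin n} (h : M.IsRepresentativeSequence x b d) : M.IsIntervalHom x b d :=
  ⟨fun k hk => by_contra fun h0 => hk ((h.ne_zero_iff k).1 h0), h.map_eq⟩

namespace IsIntervalHom

variable {M : ZigzagModule.{u, v} F o} {x y : ∀ k, M.V k} {b d : Fin n}

theorem smul_sub_smul (hx : M.IsIntervalHom x b d) (hy : M.IsIntervalHom y b d) (c c' : F) :
    M.IsIntervalHom (fun k => c • x k - c' • y k) b d where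
  eq_zero k hk := by simp [hx.eq_zero k hk, hy.eq_zero k hk]
  map_eq a h h' := by simp [hx.map_eq a h h', hy.map_eq a h h']

open Classical in
/-- There is a nonzero morphism `𝕀[B; D] → 𝕀[b; d]` when `b ≤_b B`, `d ≤_d D` and the intervals
meet. Composing it with a morphism from `𝕀[b; d]` truncates the latter to `B, …, D`. -/
theorem truncate (hx : M.IsIntervalHom x b d) {B D : Fin n} (hb : birthLE o b B)
    (hd : deathLE o d D) :
    M.IsIntervalHom (fun k => if B ≤ k ∧ k ≤ D then x k else 0) B D where
  eq_zero k hk := by simp [hk]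
  map_eq := by
    intro i j a hi hi'
    -- an arrow that would violate compatibility at one of the four ends has the direction excluded
    -- by the comparison of births or of deaths
    have key : (b ≤ i ∧ i ≤ d → (B ≤ j ∧ j ≤ D) ∨ ¬ (b ≤ j ∧ j ≤ d)) ∧
        (¬ (b ≤ i ∧ i ≤ d) → ¬ ((B ≤ j ∧ j ≤ D) ∧ (b ≤ j ∧ j ≤ d))) := by
      have h1 : b < B → ∀ k : Fin n, k.val + 1 = B.val → ¬ ZigzagArrow o B k := by
        rintro h k hk ha
        rcases hb with rfl | ⟨-, k', hk', ha'⟩ | ⟨h', -⟩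
        · exact h.false
        · obtain rfl : k = k' := Fin.ext (by omega)
          exact ZigzagArrow.not_symm ha ha'
        · exact h.asymm h'
      have h2 : B < b → ∀ k : Fin n, k.val + 1 = b.val → ¬ ZigzagArrow o k b := by
        rintro h k hk ha
        rcases hb with rfl | ⟨h', -⟩ | ⟨-, k', hk', ha'⟩
        · exact h.false
        · exact h.asymm h'
        · obtain rfl : k = k' := Fin.ext (by omega)
          exact ZigzagArrow.not_symm ha ha'
      have h3 : d < D → ∀ k : Fin n, d.val + 1 = k.val → ¬ ZigzagArrow o k d := by
        rintro h k hk ha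
        rcases hd with rfl | ⟨-, k', hk', ha'⟩ | ⟨h', -⟩
        · exact h.false
        · obtain rfl : k = k' := Fin.ext (by omega)
          exact ZigzagArrow.not_symm ha ha'
        · exact h.asymm h'
      have h4 : D < d → ∀ k : Fin n, D.val + 1 = k.val → ¬ ZigzagArrow o D k := by
        rintro h k hk ha
        rcases hd with rfl | ⟨h', -⟩ | ⟨-, k', hk', ha'⟩
        · exact h.false
        · exact h.asymm h'
        · obtain rfl : k = k' := Fin.ext (by omega)
          exact ZigzagArrow.not_symm ha ha'
      have ha : i.val + 1 = j.val ∨ j.val + 1 = i.val := a.imp And.left And.left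
      refine ⟨fun h => ?_, fun h hj => ?_⟩
      · by_contra! hc
        obtain ⟨hc, hbj, hjd⟩ := hc
        by_cases hB : B ≤ j
        · have hj := hc hB
          obtain rfl : D = i := Fin.ext (by omega)
          exact h4 (by omega) j (by omega) a
        · obtain rfl : B = i := Fin.ext (by omega)
          exact h1 (by omega) j (by omega) a
      · by_cases hB : b ≤ i
        · obtain rfl : d = j := Fin.ext (by omega)
          exact h3 (by omega) i (by omega) a
        · obtain rfl : b = j := Fin.ext (by omega)
          exact h2 (by omega) i (by omega) a
    simp only [hi, hi', and_self, if_true]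
    by_cases h : b ≤ i ∧ i ≤ d
    · rw [hx.map_eq a h.1 h.2]
      rcases key.1 h with h1 | h1
      · rw [if_pos h1]
      · rw [hx.eq_zero j h1, ite_self]
    · rw [hx.eq_zero i h, map_zero]
      have := key.2 h
      by_cases h1 : B ≤ j ∧ j ≤ D
      · rw [if_pos h1, hx.eq_zero j fun h2 => this ⟨h1, h2⟩]
      · rw [if_neg h1]

end IsIntervalHom

open Classical in
/-- The coordinate of a vector of `𝕀[b; d]` at the vertex `k`; it is `0` if the space is zero. -/
noncomputable def intervalCoord (F : Type u) [Field F] (o : Fin n → Bool) (b d k : Fin n) :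
    (interval F o b d).V k →ₗ[F] F where
  toFun f := if h : b ≤ k ∧ k ≤ d then f ⟨h⟩ else 0
  map_add' f g := by by_cases h : b ≤ k ∧ k ≤ d <;> simp [h]; rfl
  map_smul' c f := by by_cases h : b ≤ k ∧ k ≤ d <;> simp [h]; rfl

theorem intervalCoord_of_not {b d k : Fin n} (h : ¬ (b ≤ k ∧ k ≤ d))
    (f : (interval F o b d).V k) : intervalCoord F o b d k f = 0 := by
  simp [intervalCoord, h]

theorem intervalCoord_of_mem {b d k : Fin n} (h : b ≤ k ∧ k ≤ d)
    (f : (interval F o b d).V k) : intervalCoord F o b d k f = f ⟨h⟩ := by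
  simp [intervalCoord, h]

theorem intervalCoord_map {b d i j : Fin n} (a : ZigzagArrow o i j) (h : b ≤ j ∧ j ≤ d)
    (f : (interval F o b d).V i) :
    intervalCoord F o b d j ((interval F o b d).map a f) = intervalCoord F o b d i f := by
  rw [intervalCoord_of_mem h]
  rfl

/-- The morphism from a direct sum of interval modules given by its values on the canonical
generators. -/
noncomputable def intervalSumHom {ι : Type} [Fintype ι] {M : ZigzagModule.{u, v} F o}
    (y : ι → ∀ k, M.V k) (b d : ι → Fin n) (hy : ∀ t, M.IsIntervalHom (y t) (b t) (d t)) :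
    Hom (pi fun t => interval F o (b t) (d t)) M where
  app k := ∑ t, (LinearMap.toSpanSingleton F (M.V k) (y t k)).comp
    ((intervalCoord F o (b t) (d t) k).comp (LinearMap.proj t))
  comm {i j} a f := by
    simp only [LinearMap.sum_apply, LinearMap.comp_apply, map_sum]
    refine Finset.sum_congr rfl fun t _ => ?_
    simp only [LinearMap.toSpanSingleton_apply, map_smul]
    change intervalCoord F o _ _ j ((interval F o (b t) (d t)).map a (f t)) • y t j =
      intervalCoord F o _ _ i (f t) • _
    by_cases hi : b t ≤ i ∧ i ≤ d t
    · rw [(hy t).map_eq a hi.1 hi.2]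
      by_cases hj : b t ≤ j ∧ j ≤ d t
      · rw [intervalCoord_map a hj]
      · rw [(hy t).eq_zero j hj, smul_zero, smul_zero]
    · rw [intervalCoord_of_not hi, zero_smul]
      by_cases hj : b t ≤ j ∧ j ≤ d t
      · rw [intervalCoord_map a hj, intervalCoord_of_not hi, zero_smul]
      · rw [(hy t).eq_zero j hj, smul_zero]

theorem intervalSumHom_app {ι : Type} [Fintype ι] {M : ZigzagModule.{u, v} F o}
    (y : ι → ∀ k, M.V k) (b d : ι → Fin n) (hy : ∀ t, M.IsIntervalHom (y t) (b t) (d t))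
    (k : Fin n) (f : (pi fun t => interval F o (b t) (d t)).V k) :
    (intervalSumHom y b d hy).app k f =
      ∑ t, intervalCoord F o (b t) (d t) k (f t) • y t k := by
  simp [intervalSumHom]
  rfl

/-- A zigzag module that embeds into `M` is a direct sum of interval modules if its image has, at
every vertex, a basis formed by the nonzero vectors of a family of images of interval modules. -/
theorem nonempty_iso_pi_interval {ι : Type} [Fintype ι] {N : ZigzagModule.{u, w} F o}
    {M : ZigzagModule.{u, v} F o} (G : Hom N M) (hG : ∀ k, Function.Injective (G.app k))
    (y : ι → ∀ k, M.V k) (b d : ι → Fin n) (hy : ∀ t, M.IsIntervalHom (y t) (b t) (d t))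
    (hli : ∀ k, LinearIndepOn F (fun t => y t k) {t | b t ≤ k ∧ k ≤ d t})
    (hspan : ∀ k, Submodule.span F (Set.range fun t => y t k) = LinearMap.range (G.app k)) :
    Nonempty (Iso N (pi fun t => interval F o (b t) (d t))) := by
  classical
  refine nonempty_iso_of_range_eq G (intervalSumHom y b d hy) hG (fun k => ?_) fun k => ?_
  · rw [injective_iff_map_eq_zero]
    intro f hf
    rw [intervalSumHom_app] at hf
    have h := linearIndepOn_iff''.1 (hli k) {t | b t ≤ k ∧ k ≤ d t}
      (fun t => intervalCoord F o (b t) (d t) k (f t)) (by simp)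
      (fun t ht => intervalCoord_of_not (by simpa using ht) _)
      (by
        rw [← hf]
        refine Finset.sum_subset (Finset.subset_univ _) fun t _ ht => ?_
        rw [intervalCoord_of_not (by simpa using ht), zero_smul])
    funext t
    funext p
    have := h t (by simpa using p.down)
    rwa [intervalCoord_of_mem p.down] at this
  · rw [← hspan]
    refine le_antisymm (Submodule.span_le.2 ?_) ?_
    · rintro _ ⟨t, rfl⟩
      by_cases ht : b t ≤ k ∧ k ≤ d t
      · let e : (interval F o (b t) (d t)).V k := fun _ => (1 : F)
        have he : intervalCoord F o (b t) (d t) k e = 1 := intervalCoord_of_mem ht e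
        refine ⟨(Pi.single t e : ∀ t, (interval F o (b t) (d t)).V k), ?_⟩
        refine (intervalSumHom_app y b d hy k _).trans ?_
        rw [Finset.sum_eq_single t]
        · rw [Pi.single_eq_same, he, one_smul]
        · intro t' _ h
          rw [Pi.single_eq_of_ne h, map_zero, zero_smul]
        · simp
      · change y t k ∈ _
        rw [(hy t).eq_zero k ht]
        exact Submodule.zero_mem _
    · rintro _ ⟨f, rfl⟩
      rw [intervalSumHom_app]
      exact Submodule.sum_mem _ fun t _ =>
        Submodule.smul_mem _ _ (Submodule.subset_span ⟨t, rfl⟩)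

end ZigzagModule

namespace ZigzagModule

variable {F : Type u} [Field F] {n : ℕ} {o : Fin n → Bool}

/-! ### The diamond as a morphism, and the surjective case -/

namespace ReversedReflectionDiamond

variable {𝕍 : ZigzagModule.{u, v} F o} {𝕎 : ZigzagModule.{u, w} F o} {l m r : Fin n}

/-- The vertex of the diamond is a source. -/
theorem not_arrow_to (Δ : ReversedReflectionDiamond 𝕍 𝕎 l m r) (i : Fin n) :
    ¬ ZigzagArrow o i m := by
  intro a
  rcases a.imp And.left And.left with h | h
  · obtain rfl : l = i := Fin.ext (by have := Δ.left_eq; omega)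
    exact Δ.arrow_left.not_symm a
  · obtain rfl : r = i := Fin.ext (by have := Δ.right_eq; omega)
    exact Δ.arrow_right.not_symm a

/-- A reversed reflection diamond is a morphism from its top module to its bottom module that is
bijective away from the vertex of the diamond. -/
theorem exists_hom (Δ : ReversedReflectionDiamond 𝕍 𝕎 l m r) :
    ∃ G : Hom 𝕎 𝕍, (∀ k ≠ m, Function.Bijective (G.app k)) ∧ G.app m = Δ.g := by
  classical
  let f : ∀ k, 𝕎.V k →ₗ[F] 𝕍.V k :=
    Function.update (fun k => if h : k = m then 0 else (Δ.φ k h).toLinearMap) m Δ.g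
  have hf : ∀ k (h : k ≠ m), f k = (Δ.φ k h).toLinearMap := by
    intro k h
    simp [f, h]
  have hm : f m = Δ.g := by simp [f]
  refine ⟨⟨f, ?_⟩, fun k h => ?_, hm⟩
  · intro i j a x
    have hj : j ≠ m := by
      rintro rfl
      exact Δ.not_arrow_to i a
    by_cases hi : i = m
    · subst hi
      rw [hf j hj, hm]
      rcases a.imp And.left And.left with h | h
      · obtain rfl : r = j := Fin.ext (by have := Δ.right_eq; omega)
        exact Δ.comm_right hj x
      · obtain rfl : l = j := Fin.ext (by have := Δ.left_eq; omega)
        exact Δ.comm_left hj x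
    · rw [hf j hj, hf i hi]
      exact Δ.φ_comm a hi hj x
  · change Function.Bijective (f k)
    rw [hf k h]
    exact (Δ.φ k h).bijective

/-- If `g` is surjective with a one-dimensional kernel, then the kernel of the morphism `𝕎 → 𝕍` is
a copy of `𝕀[m; m]`; it splits off because no arrow ends at `m`. -/
theorem nonempty_iso_of_surjective (Δ : ReversedReflectionDiamond 𝕍 𝕎 l m r)
    (hg : Function.Surjective Δ.g) (hker : Module.finrank F (LinearMap.ker Δ.g) = 1) :
    Nonempty (Iso 𝕎 (𝕍.prod (interval F o m m))) := by
  classical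
  obtain ⟨G, hG, hGm⟩ := Δ.exists_hom
  have : Module.Finite F (LinearMap.ker Δ.g) := Module.finite_of_finrank_eq_succ hker
  let ε : LinearMap.ker Δ.g ≃ₗ[F] F := LinearEquiv.ofFinrankEq _ _ (by simp [hker])
  obtain ⟨χ₀, hχ₀⟩ := LinearMap.exists_extend ε.toLinearMap
  have hε : ∀ z (hz : z ∈ LinearMap.ker Δ.g), χ₀ z = ε ⟨z, hz⟩ := fun z hz =>
    congrArg (fun f => f ⟨z, hz⟩) hχ₀
  let χm : 𝕎.V m →ₗ[F] (interval F o m m).V m :=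
    { toFun := fun z _ => χ₀ z
      map_add' := fun z z' => funext fun _ => map_add χ₀ z z'
      map_smul' := fun c z => funext fun _ => map_smul χ₀ c z }
  let χ : ∀ k, 𝕎.V k →ₗ[F] (interval F o m m).V k := Function.update (fun _ => 0) m χm
  have hχm : χ m = χm := by simp [χ]
  have hbij : ∀ k, Function.Bijective ((G.app k).prod (χ k)) := by
    intro k
    by_cases hk : k = m
    · subst hk
      rw [hGm, hχm]
      constructor
      · rw [injective_iff_map_eq_zero]
        intro z hz
        have hz1 : Δ.g z = 0 := congrArg Prod.fst hz
        have hz2 : χ₀ z = 0 := congrFun (congrArg Prod.snd hz) ⟨le_refl _, le_refl _⟩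
        rw [hε z hz1] at hz2
        exact congrArg Subtype.val ((LinearEquiv.map_eq_zero_iff ε).1 hz2)
      · rintro ⟨y, f⟩
        obtain ⟨z, rfl⟩ := hg y
        let c : F := f ⟨le_refl _, le_refl _⟩
        let z' := ε.symm (c - χ₀ z)
        refine ⟨z + z', Prod.ext ?_ (funext fun p => ?_)⟩
        · change Δ.g (z + z') = Δ.g z
          rw [map_add, LinearMap.mem_ker.1 z'.2, add_zero]
        · change χ₀ (z + z') = f p
          rw [map_add, hε _ z'.2]
          change χ₀ z + ε z' = f p
          rw [LinearEquiv.apply_symm_apply, add_sub_cancel]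
    · have hempty : ∀ f f' : (interval F o m m).V k, f = f' := fun f f' =>
        funext fun p => absurd (le_antisymm p.down.2 p.down.1) hk
      constructor
      · intro z z' h
        exact (hG k hk).1 (congrArg Prod.fst h)
      · rintro ⟨y, f⟩
        obtain ⟨z, rfl⟩ := (hG k hk).2 y
        exact ⟨z, Prod.ext rfl (hempty _ _)⟩
  refine ⟨⟨fun k => LinearEquiv.ofBijective _ (hbij k), fun {i j} a x => ?_⟩⟩
  refine Prod.ext (G.comm a x) (funext fun p => ?_)
  obtain rfl : j = m := le_antisymm p.down.2 p.down.1
  exact absurd a (Δ.not_arrow_to i)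

end ReversedReflectionDiamond

/-! ### Triangular changes of basis -/

/-- A family that is triangular with respect to a linearly independent family, with nonzero
diagonal entries, is linearly independent and spans the same subspace. -/
theorem linearIndepOn_and_span_eq_of_triangular {ι : Type*} {V : Type*} [Finite ι]
    [AddCommGroup V] [Module F V] {x y : ι → V} {s : Set ι} (hx : LinearIndepOn F x s)
    (τ : ι → ℕ) (c : ι → F) (hc : ∀ i ∈ s, c i ≠ 0)
    (h : ∀ i ∈ s, y i - c i • x i ∈ Submodule.span F (x '' {j | j ∈ s ∧ τ j < τ i})) :
    LinearIndepOn F y s ∧ Submodule.span F (y '' s) = Submodule.span F (x '' s) := by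
  classical
  have hle : ∀ N i, i ∈ s → τ i < N → x i ∈ Submodule.span F (y '' s) := by
    intro N
    induction N with
    | zero => intro i _ h; omega
    | succ N ih =>
      intro i hi hN
      have h1 : y i - c i • x i ∈ Submodule.span F (y '' s) := by
        refine Submodule.span_le.2 ?_ (h i hi)
        rintro _ ⟨j, ⟨hj, hji⟩, rfl⟩
        exact ih j hj (by omega)
      have h2 : c i • x i ∈ Submodule.span F (y '' s) := by
        have := Submodule.sub_mem _ (Submodule.subset_span (Set.mem_image_of_mem y hi)) h1
        rwa [sub_sub_cancel] at this
      exact (Submodule.smul_mem_iff _ (hc i hi)).1 h2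
  have hspan : Submodule.span F (y '' s) = Submodule.span F (x '' s) := by
    refine le_antisymm (Submodule.span_le.2 ?_) (Submodule.span_le.2 ?_)
    · rintro _ ⟨i, hi, rfl⟩
      have h1 := Submodule.span_mono (R := F) (Set.image_mono (f := x)
        (fun j (hj : j ∈ {j | j ∈ s ∧ τ j < τ i}) => hj.1)) (h i hi)
      have h2 := Submodule.add_mem _ h1 (Submodule.smul_mem _ (c i)
        (Submodule.subset_span (Set.mem_image_of_mem x hi)))
      rwa [sub_add_cancel] at h2
    · rintro _ ⟨i, hi, rfl⟩
      exact hle _ i hi (Nat.lt_succ_self _)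
  -- independence follows by comparing dimensions, as both families have the same length
  refine ⟨?_, hspan⟩
  have := Fintype.ofFinite s
  have hx' := linearIndependent_iff_card_eq_finrank_span.1 hx
  refine linearIndependent_iff_card_eq_finrank_span.2 ?_
  rw [hx', Set.finrank, Set.finrank]
  have e : ∀ z : ι → V, Set.range (fun i : s => z i) = z '' s := fun z => by
    rw [Set.image_eq_range]
  rw [e, e, hspan]

end ZigzagModule

/-! ### The greedy rule and the birth order -/

section Greedy

variable {n q : ℕ} {le : Fin n → Fin n → Prop} {b : Fin (q + 1) → Fin n}
  {ℓ : Fin (q + 1) → Fin (q + 1)}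

namespace IsGreedyPairing

/-- At the start of step `j` exactly the births before `j` and one further birth, the pivot `c`,
are paired. The pivot precedes all births that are not yet paired. -/
theorem exists_pivot (h : IsGreedyPairing le b ℓ) (j : Fin (q + 1)) :
    ∃ c, j ≤ c ∧ (∀ k, NotYetPaired ℓ j k ↔ j ≤ k ∧ k ≠ c) ∧
      (c = ℓ (Fin.last q) ∨ ∃ i < j, c = ℓ i) ∧ ∀ k, NotYetPaired ℓ j k → le (b c) (b k) := by
  induction j using Fin.induction with
  | zero =>
    refine ⟨ℓ (Fin.last q), Fin.zero_le _, fun k => ?_, .inl rfl, fun k _ => h.last k⟩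
    simp [NotYetPaired]
  | succ j ih =>
    obtain ⟨c, hjc, hiff, hc, hmin⟩ := ih
    have hsucc : ∀ k, NotYetPaired ℓ j.succ k ↔ NotYetPaired ℓ j.castSucc k ∧
        k ≠ ℓ j.castSucc := by
      intro k
      simp only [NotYetPaired, and_assoc, and_congr_right_iff]
      intro _
      constructor
      · intro h
        exact ⟨fun i hi => h i (hi.trans (Fin.castSucc_lt_succ)), h _ (Fin.castSucc_lt_succ)⟩
      · rintro ⟨h1, h2⟩ i hi
        rcases (Fin.le_castSucc_iff.2 hi).lt_or_eq with h3 | rfl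
        · exact h1 i h3
        · exact h2
    have hlt : ∀ k : Fin (q + 1), j.succ ≤ k ↔ j.castSucc ≤ k ∧ k ≠ j.castSucc := by
      intro k
      simp only [Fin.le_def, Fin.val_succ, Fin.val_castSucc, ne_eq, Fin.ext_iff]
      omega
    by_cases hcj : c = j.castSucc
    · subst hcj
      have hn : ¬ NotYetPaired ℓ j.castSucc j.castSucc := by simp [hiff]
      obtain ⟨h1, h2⟩ := h.choose_min _ (Fin.castSucc_lt_last j) hn
      refine ⟨ℓ j.castSucc, (hlt _).2 ((hiff _).1 h1), fun k => ?_,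
        .inr ⟨_, Fin.castSucc_lt_succ, rfl⟩, fun k hk => h2 k ((hsucc k).1 hk).1⟩
      rw [hsucc, hiff, hlt]
    · have hn : NotYetPaired ℓ j.castSucc j.castSucc :=
        (hiff _).2 ⟨le_refl _, Ne.symm hcj⟩
      have hk := h.keep _ (Fin.castSucc_lt_last j) hn
      refine ⟨c, (hlt _).2 ⟨hjc, hcj⟩, fun k => ?_, ?_, fun k hk => hmin k ((hsucc k).1 hk).1⟩
      · rw [hsucc, hiff, hlt, hk]
        tauto
      · exact hc.imp_right fun ⟨i, hi, e⟩ => ⟨i, hi.trans Fin.castSucc_lt_succ, e⟩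

/-- The pivot `c` of step `j` and the birth `ℓ j` are `j` and a later index, in some order. -/
theorem exists_pivot_of_castSucc (h : IsGreedyPairing le b ℓ) (j : Fin q) :
    ∃ c, (c = ℓ (Fin.last q) ∨ ∃ i < j, c = ℓ i.castSucc) ∧ le (b c) (b (ℓ j.castSucc)) ∧
      ((ℓ j.castSucc = j.castSucc ∧ j.castSucc < c) ∨
        (c = j.castSucc ∧ j.castSucc < ℓ j.castSucc)) ∧
      NotYetPaired ℓ j.castSucc (ℓ j.castSucc) := by
  obtain ⟨c, hjc, hiff, hc, hmin⟩ := h.exists_pivot j.castSucc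
  refine ⟨c, hc.imp_right ?_, ?_⟩
  · rintro ⟨i, hi, rfl⟩
    exact ⟨i.castLT (by have := j.2; simp [Fin.lt_def] at hi; omega), hi, rfl⟩
  by_cases hcj : c = j.castSucc
  · have hn : ¬ NotYetPaired ℓ j.castSucc j.castSucc := by simp [hiff, hcj]
    obtain ⟨h1, -⟩ := h.choose_min _ (Fin.castSucc_lt_last j) hn
    have h2 := (hiff _).1 h1
    exact ⟨hmin _ h1, .inr ⟨hcj, lt_of_le_of_ne h2.1 (hcj ▸ h2.2.symm)⟩, h1⟩
  · have hn : NotYetPaired ℓ j.castSucc j.castSucc := (hiff _).2 ⟨le_refl _, Ne.symm hcj⟩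
    have hk := h.keep _ (Fin.castSucc_lt_last j) hn
    rw [hk]
    exact ⟨hmin _ hn, .inl ⟨rfl, lt_of_le_of_ne hjc (Ne.symm hcj)⟩, hn⟩

theorem bijective (h : IsGreedyPairing le b ℓ) : Function.Bijective ℓ := by
  rw [← Finite.injective_iff_bijective]
  have hn : ∀ j < Fin.last q, NotYetPaired ℓ j (ℓ j) := by
    intro j hj
    have := h.exists_pivot_of_castSucc (j.castLT hj)
    exact this.choose_spec.2.2.2
  have hlt : ∀ i j, i < j → ℓ i ≠ ℓ j := by
    intro i j hij
    rcases (Fin.le_last j).lt_or_eq with hj | rfl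
    · exact ((hn j hj).2 i hij).symm
    · exact (hn i hij).1
  intro i j hij
  by_contra hne
  rcases lt_or_gt_of_ne hne with h' | h'
  · exact hlt _ _ h' hij
  · exact hlt _ _ h' hij.symm

end IsGreedyPairing

/-- The greedy rule can be carried out whenever births are compared through integer keys: before
step `j` fewer than `q + 1` births are paired. -/
theorem exists_isGreedyPairing {key : Fin n → ℤ} (hle : ∀ i j, le i j ↔ key i ≤ key j)
    (b : Fin (q + 1) → Fin n) : ∃ ℓ, IsGreedyPairing le b ℓ := by
  classical
  have hmin : ∀ s : Finset (Fin (q + 1)), s.Nonempty → ∃ k ∈ s, ∀ k' ∈ s, le (b k) (b k') := by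
    intro s hs
    obtain ⟨k, hk, hk'⟩ := s.exists_min_image (fun k => key (b k)) hs
    exact ⟨k, hk, fun k' h => (hle _ _).2 (hk' k' h)⟩
  have main : ∀ N ≤ q, ∃ ℓ : Fin (q + 1) → Fin (q + 1),
      (∀ k, le (b (ℓ (Fin.last q))) (b k)) ∧ ∀ j : Fin (q + 1), j.val < N →
        (NotYetPaired ℓ j j → ℓ j = j) ∧ (¬ NotYetPaired ℓ j j →
          NotYetPaired ℓ j (ℓ j) ∧ ∀ k, NotYetPaired ℓ j k → le (b (ℓ j)) (b k)) := by
    intro N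
    induction N with
    | zero =>
      intro _
      obtain ⟨k, -, hk⟩ := hmin Finset.univ Finset.univ_nonempty
      exact ⟨fun _ => k, fun k' => hk k' (Finset.mem_univ _), fun j hj => absurd hj (by omega)⟩
    | succ N ih =>
      intro hN
      obtain ⟨ℓ, h1, h2⟩ := ih (by omega)
      let j₀ : Fin (q + 1) := ⟨N, by omega⟩
      have hj₀ : Fin.last q ≠ j₀ := by simp [Fin.ext_iff, j₀]; omega
      have hpair : ∀ a (j k : Fin (q + 1)), j ≤ j₀ →
          (NotYetPaired (Function.update ℓ j₀ a) j k ↔ NotYetPaired ℓ j k) := by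
        intro a j k hj
        unfold NotYetPaired
        rw [Function.update_of_ne hj₀]
        refine and_congr_right fun _ => forall₂_congr fun i hi => ?_
        rw [Function.update_of_ne (hi.trans_le hj).ne]
      obtain ⟨a, ha⟩ : ∃ a, (NotYetPaired ℓ j₀ j₀ → a = j₀) ∧ (¬ NotYetPaired ℓ j₀ j₀ →
          NotYetPaired ℓ j₀ a ∧ ∀ k, NotYetPaired ℓ j₀ k → le (b a) (b k)) := by
        by_cases h : NotYetPaired ℓ j₀ j₀
        · exact ⟨j₀, fun _ => rfl, fun h' => absurd h h'⟩
        · obtain ⟨k, hk⟩ : ∃ k, k ∉ (insert (Fin.last q) (Finset.Iio j₀)).image ℓ := by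
            by_contra! hall
            have h3 := Finset.card_le_card fun k (_ : k ∈ Finset.univ) => hall k
            have h4 := h3.trans Finset.card_image_le
            have h5 := h4.trans (Finset.card_insert_le _ _)
            simp [j₀] at h5
            omega
          have hk : NotYetPaired ℓ j₀ k := by
            refine ⟨fun e => hk ?_, fun i hi e => hk ?_⟩
            · exact Finset.mem_image.2 ⟨_, Finset.mem_insert_self _ _, e.symm⟩
            · exact Finset.mem_image.2 ⟨i, by simp [hi], e.symm⟩
          obtain ⟨a, ha, ha'⟩ := hmin (Finset.univ.filter (NotYetPaired ℓ j₀)) ⟨k, by simpa⟩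
          exact ⟨a, fun h' => absurd h' h, fun _ =>
            ⟨by simpa using ha, fun k hk => ha' k (by simpa using hk)⟩⟩
      refine ⟨Function.update ℓ j₀ a, ?_, fun j hj => ?_⟩
      · rwa [Function.update_of_ne hj₀]
      · have hj' : j ≤ j₀ := by simp [Fin.le_def, j₀]; omega
        simp only [hpair a j _ hj']
        rcases hj'.lt_or_eq with hj' | rfl
        · rw [Function.update_of_ne hj'.ne]
          exact h2 j hj'
        · rw [Function.update_self]
          exact ha
  obtain ⟨ℓ, h1, h2⟩ := main q le_rfl
  exact ⟨ℓ, h1, fun j hj => (h2 j hj).1, fun j hj => (h2 j hj).2⟩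

open Classical in
/-- The vertex `j` with a sign given by the direction of the arrow between `j - 1` and `j`. -/
noncomputable def birthKey (o : Fin n → Bool) (j : Fin n) : ℤ :=
  if ∃ k : Fin n, k.val + 1 = j.val ∧ ZigzagArrow o k j then j.val else -j.val

/-- The birth order is a linear order: it compares the integers `birthKey o j`. -/
theorem birthLE_iff (o : Fin n → Bool) (i j : Fin n) :
    birthLE o i j ↔ birthKey o i ≤ birthKey o j := by
  have hback : ∀ i : Fin n, 0 < i.val → ((∃ k : Fin n, k.val + 1 = i.val ∧ ZigzagArrow o i k) ↔
      ¬ ∃ k : Fin n, k.val + 1 = i.val ∧ ZigzagArrow o k i) := by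
    intro i hi
    constructor
    · rintro ⟨k, hk, a⟩ ⟨k', hk', a'⟩
      obtain rfl : k = k' := Fin.ext (by omega)
      exact a.not_symm a'
    · intro h
      let k : Fin n := ⟨i.val - 1, by omega⟩
      have hk : k.val + 1 = i.val := by simp [k]; omega
      refine ⟨k, hk, .inr ⟨hk, ?_⟩⟩
      by_contra ho
      exact h ⟨k, hk, .inl ⟨hk, by simpa using ho⟩⟩
  unfold birthLE birthKey
  rcases lt_trichotomy i j with h | rfl | h
  · simp only [h.ne, h, h.asymm, true_and, false_and, or_false, false_or]
    split_ifs with h1 h2 h2 <;> simp [*] <;> omega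
  · simp
  · simp only [h.ne', h, h.asymm, true_and, false_and, false_or]
    rw [hback i (by omega)]
    split_ifs with h1 h2 h2 <;> simp [*] <;> omega

end Greedy

namespace ZigzagModule

variable {F : Type u} [Field F] {n : ℕ} {o : Fin n → Bool}

/-! ### Interval bases of submodules -/

/-- A linearly independent family of images of interval modules spans a submodule of `M` that is
the direct sum of these interval modules. -/
theorem exists_iso_pi_interval {T : Type} [Fintype T] {M : ZigzagModule.{u, v} F o}
    (x : T → ∀ k, M.V k) (b d : T → Fin n) (hx : ∀ t, M.IsIntervalHom (x t) (b t) (d t))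
    (hli : ∀ k, LinearIndepOn F (fun t => x t k) {t | b t ≤ k ∧ k ≤ d t}) :
    ∃ X : ZigzagModule.{u, v} F o,
      Nonempty (Iso X (pi fun t => interval F o (b t) (d t))) := by
  have hmap : ∀ {i j : Fin n} (a : ZigzagArrow o i j),
      ∀ z ∈ Submodule.span F (Set.range fun t => x t i),
        M.map a z ∈ Submodule.span F (Set.range fun t => x t j) := by
    intro i j a z hz
    refine (Submodule.span_le (p := (Submodule.span F (Set.range fun t => x t j)).comap
      (M.map a))).2 ?_ hz
    rintro _ ⟨t, rfl⟩
    change M.map a (x t i) ∈ Submodule.span F (Set.range fun t => x t j)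
    by_cases ht : b t ≤ i ∧ i ≤ d t
    · rw [(hx t).map_eq a ht.1 ht.2]
      exact Submodule.subset_span ⟨t, rfl⟩
    · rw [(hx t).eq_zero i ht, map_zero]
      exact Submodule.zero_mem _
  let X : ZigzagModule.{u, v} F o :=
    { V := fun k => Submodule.span F (Set.range fun t => x t k)
      map := fun a => (M.map a).restrict (hmap a) }
  let G : Hom X M :=
    { app := fun k => Submodule.subtype (Submodule.span F (Set.range fun t => x t k))
      comm := fun _ _ => rfl }
  refine ⟨X, nonempty_iso_pi_interval G (fun k => Submodule.subtype_injective _) x b d hx hli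
    fun k => (Submodule.range_subtype _).symm⟩

theorem span_range_eq_span_image {ι V : Type*} [AddCommGroup V] [Module F V] {x : ι → V}
    {s : Set ι} (h : ∀ i ∉ s, x i = 0) :
    Submodule.span F (Set.range x) = Submodule.span F (x '' s) := by
  refine le_antisymm (Submodule.span_le.2 ?_) (Submodule.span_mono (Set.image_subset_range _ _))
  rintro _ ⟨i, rfl⟩
  by_cases hi : i ∈ s
  · exact Submodule.subset_span ⟨i, hi, rfl⟩
  · rw [SetLike.mem_coe, h i hi]
    exact Submodule.zero_mem _

/-- Numbering of `T ⊕ Fin (q + 1)` that reorders the second summand by `σ` and separates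
its last element. -/
def reindex {T : Type} {q : ℕ} (σ : Fin (q + 1) → Fin (q + 1)) :
    (T ⊕ Unit) ⊕ Fin q → T ⊕ Fin (q + 1) :=
  Sum.elim (Sum.elim Sum.inl fun _ => Sum.inr (σ (Fin.last q))) fun j => Sum.inr (σ j.castSucc)

theorem reindex_bijective {T : Type} {q : ℕ} {σ : Fin (q + 1) → Fin (q + 1)}
    (hσ : Function.Bijective σ) : Function.Bijective (reindex (T := T) σ) := by
  constructor
  · rintro ((t | _) | j) ((t' | _) | j') h <;> simp [reindex, hσ.1.eq_iff] at h ⊢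
    · exact h
    · exact absurd h.symm (Fin.castSucc_lt_last _).ne
    · exact h
  · rintro (t | j)
    · exact ⟨.inl (.inl t), rfl⟩
    · obtain ⟨j, rfl⟩ := hσ.2 j
      induction j using Fin.lastCases with
      | last => exact ⟨.inl (.inr ()), rfl⟩
      | cast j => exact ⟨.inr j, rfl⟩

/-- Replacing all but one of the vectors `x (inr j)` by combinations with two terms, triangular in
the order given by `σ` and `τ`, changes neither linear independence nor the span. -/
theorem linearIndepOn_and_span_eq_of_two_term {V : Type*} [AddCommGroup V] [Module F V] {T : Type}
    [Finite T] {q : ℕ} {x : T ⊕ Fin (q + 1) → V} {A : Set (T ⊕ Fin (q + 1))}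
    (hx : LinearIndepOn F x A) (hx0 : ∀ i ∉ A, x i = 0) {σ : Fin (q + 1) → Fin (q + 1)}
    (hσ : Function.Bijective σ) (τ : Fin (q + 1) → ℕ) (z : Fin q → V)
    (hz : ∀ j, ∃ (c c' : F) (k : Fin (q + 1)), c ≠ 0 ∧ τ k < τ j.castSucc ∧
      z j = c • x (.inr (σ j.castSucc)) + c' • x (.inr (σ k))) :
    let y : (T ⊕ Unit) ⊕ Fin q → V :=
      Sum.elim (Sum.elim (fun t => x (.inl t)) fun _ => x (.inr (σ (Fin.last q)))) z
    LinearIndepOn F y (reindex σ ⁻¹' A) ∧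
      Submodule.span F (y '' (reindex σ ⁻¹' A)) = Submodule.span F (Set.range x) := by
  intro y
  have hbij := reindex_bijective (T := T) hσ
  have himg : reindex σ '' (reindex σ ⁻¹' A) = A := Set.image_preimage_eq A hbij.2
  have hxs : LinearIndepOn F (x ∘ reindex σ) (reindex σ ⁻¹' A) := by
    refine LinearIndepOn.comp_of_image ?_ hbij.1.injOn
    rwa [himg]
  choose c c' k hc hτ hzj using hz
  obtain ⟨h1, h2⟩ := linearIndepOn_and_span_eq_of_triangular (y := y) hxs
    (Sum.elim (Sum.elim (fun _ => 0) fun _ => τ (Fin.last q)) fun j => τ j.castSucc)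
    (Sum.elim (fun _ => 1) c)
    (by rintro (_ | j) _ <;> simp [hc])
    (by
      rintro ((t | _) | j) hi
      · simp [y, reindex]
      · simp [y, reindex]
      · have e : y (.inr j) - c j • (x ∘ reindex σ) (.inr j) = c' j • x (.inr (σ (k j))) := by
          simp [y, reindex, hzj]
        change y (.inr j) - c j • (x ∘ reindex σ) (.inr j) ∈ _
        rw [e]
        refine Submodule.smul_mem _ _ ?_
        by_cases hk : (Sum.inr (σ (k j)) : T ⊕ Fin (q + 1)) ∈ A
        · have := hτ j
          generalize k j = k' at hk this
          induction k' using Fin.lastCases with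
          | last => exact Submodule.subset_span ⟨.inl (.inr ()), ⟨hk, this⟩, rfl⟩
          | cast k' => exact Submodule.subset_span ⟨.inr k', ⟨hk, this⟩, rfl⟩
        · rw [hx0 _ hk]
          exact Submodule.zero_mem _)
  refine ⟨h1, h2.trans ?_⟩
  rw [Set.image_comp, himg, span_range_eq_span_image hx0]

/-! ### The injective case -/

namespace ReversedReflectionDiamond

variable {𝕍 : ZigzagModule.{u, v} F o} {𝕎 : ZigzagModule.{u, w} F o} {l m r : Fin n}

theorem deathLE_left (Δ : ReversedReflectionDiamond 𝕍 𝕎 l m r) {d : Fin n} (h : r ≤ d) :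
    deathLE o d l :=
  .inr (.inr ⟨by have := Δ.left_eq; have := Δ.right_eq; omega, m, Δ.left_eq, Δ.arrow_left⟩)

theorem birthLE_right (Δ : ReversedReflectionDiamond 𝕍 𝕎 l m r) {b : Fin n} (h : b ≤ l) :
    birthLE o b r :=
  .inr (.inl ⟨by have := Δ.left_eq; have := Δ.right_eq; omega, m, Δ.right_eq, Δ.arrow_right⟩)

/-- If `g` is injective with image the kernel of `α`, then `𝕎` is the direct sum of the intervals of
`𝕍` on which `α` vanishes, of the minimal birth with the death `l`, of the birth `r` with
the minimal death, and of the intervals obtained from the greedy pairing. The family `x` consists of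
generators of the intervals of `𝕍`; `α` vanishes on the first part of it, and on no member of the
second part. -/
theorem nonempty_iso_of_injective (Δ : ReversedReflectionDiamond 𝕍 𝕎 l m r)
    (hg : Function.Injective Δ.g) {T : Type} [Fintype T] {q : ℕ}
    (x : T ⊕ Fin (q + 1) → ∀ k, 𝕍.V k) (b d : T ⊕ Fin (q + 1) → Fin n)
    (hx : ∀ i, 𝕍.IsIntervalHom (x i) (b i) (d i))
    (hli : ∀ k, LinearIndepOn F (fun i => x i k) {i | b i ≤ k ∧ k ≤ d i})
    (hspan : ∀ k, Submodule.span F (Set.range fun i => x i k) = ⊤)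
    (hb : ∀ j, b (.inr j) ≤ l) (hd : ∀ j, r ≤ d (.inr j))
    (hdle : ∀ j k, j ≤ k → deathLE o (d (.inr k)) (d (.inr j)))
    (α : 𝕍.V m →ₗ[F] F) (hα : LinearMap.range Δ.g = LinearMap.ker α)
    (hαT : ∀ t, α (x (.inl t) m) = 0) (hαs : ∀ j, α (x (.inr j) m) ≠ 0)
    {ℓ : Fin (q + 1) → Fin (q + 1)}
    (hℓ : IsGreedyPairing (birthLE o) (fun j => b (.inr j)) ℓ) :
    Nonempty (Iso 𝕎 (pi fun i : ((T ⊕ Unit) ⊕ Unit) ⊕ Fin q => interval F o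
      (Sum.elim (Sum.elim (Sum.elim (fun t => b (.inl t)) fun _ => b (.inr (ℓ (Fin.last q))))
        fun _ => r) (fun j => b (.inr (ℓ j.castSucc))) i)
      (Sum.elim (Sum.elim (Sum.elim (fun t => d (.inl t)) fun _ => l)
        fun _ => d (.inr (Fin.last q))) (fun j => d (.inr j.castSucc)) i))) := by
  classical
  obtain ⟨G, hG, hGm⟩ := Δ.exists_hom
  have hlm := Δ.left_eq
  have hmr := Δ.right_eq
  choose c hc hcb hcℓ _ using fun j => hℓ.exists_pivot_of_castSucc j
  set a : Fin (q + 1) → F := fun j => α (x (.inr j) m) with ha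
  -- the vector `z j` lies in the kernel of `α` at the vertex `m`
  let z : Fin q → ∀ k, 𝕍.V k := fun j k =>
    a (c j) • x (.inr (ℓ j.castSucc)) k - a (ℓ j.castSucc) • x (.inr (c j)) k
  let tr : (∀ k, 𝕍.V k) → Fin n → Fin n → ∀ k, 𝕍.V k := fun x B D k =>
    if B ≤ k ∧ k ≤ D then x k else 0
  set b' : ((T ⊕ Unit) ⊕ Unit) ⊕ Fin q → Fin n :=
    Sum.elim (Sum.elim (Sum.elim (fun t => b (.inl t)) fun _ => b (.inr (ℓ (Fin.last q))))
        fun _ => r) (fun j => b (.inr (ℓ j.castSucc))) with hb'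
  set d' : ((T ⊕ Unit) ⊕ Unit) ⊕ Fin q → Fin n :=
    Sum.elim (Sum.elim (Sum.elim (fun t => d (.inl t)) fun _ => l)
        fun _ => d (.inr (Fin.last q))) (fun j => d (.inr j.castSucc)) with hd'
  let y : ((T ⊕ Unit) ⊕ Unit) ⊕ Fin q → ∀ k, 𝕍.V k :=
    Sum.elim (Sum.elim (Sum.elim (fun t => x (.inl t))
      fun _ => tr (x (.inr (ℓ (Fin.last q)))) (b (.inr (ℓ (Fin.last q)))) l)
      fun _ => tr (x (.inr (Fin.last q))) r (d (.inr (Fin.last q))))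
      fun j => tr (z j) (b (.inr (ℓ j.castSucc))) (d (.inr j.castSucc))
  have hy : ∀ i, 𝕍.IsIntervalHom (y i) (b' i) (d' i) := by
    rintro (((t | _) | _) | j)
    · exact hx _
    · exact (hx _).truncate (.inl rfl) (Δ.deathLE_left (hd _))
    · exact (hx _).truncate (Δ.birthLE_right (hb _)) (.inl rfl)
    · have h1 : j.castSucc ≤ ℓ j.castSucc ∧ j.castSucc ≤ c j := by
        rcases hcℓ j with h | h
        · exact ⟨h.1.ge, h.2.le⟩
        · exact ⟨h.2.le, h.1.ge⟩
      have := ((hx (.inr (ℓ j.castSucc))).truncate (.inl rfl) (hdle _ _ h1.1)).smul_sub_smul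
        ((hx (.inr (c j))).truncate (hcb j) (hdle _ _ h1.2)) (a (c j)) (a (ℓ j.castSucc))
      refine (congrArg (fun f => 𝕍.IsIntervalHom f _ _) (funext fun k => ?_)).mpr this
      change (if _ then _ else _) = _
      split_ifs <;> simp
  have hy0 : ∀ k, ∀ i ∉ {i | b' i ≤ k ∧ k ≤ d' i}, y i k = 0 := fun k i hi =>
    (hy i).eq_zero k hi
  -- to the left of the diamond and at its vertex, the order of pairing makes the `z j` triangular
  have hleft := fun k => linearIndepOn_and_span_eq_of_two_term (hli k)
    (fun i hi => (hx i).eq_zero k hi) hℓ.bijective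
    (fun i => if i = Fin.last q then 0 else i.val + 1) (fun j => z j k) (by
      intro j
      rcases hc j with h | ⟨i, hi, h⟩
      · refine ⟨a (c j), -a (ℓ j.castSucc), Fin.last q, hαs _, ?_, ?_⟩
        · simp [(Fin.castSucc_lt_last j).ne]
        · simp only [z, h, neg_smul, sub_eq_add_neg]
      · refine ⟨a (c j), -a (ℓ j.castSucc), i.castSucc, hαs _, ?_, ?_⟩
        · simpa [(Fin.castSucc_lt_last j).ne, (Fin.castSucc_lt_last i).ne] using hi
        · simp only [z, h, neg_smul, sub_eq_add_neg])
  -- to its right, the order of the deaths does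
  have hright := fun k => linearIndepOn_and_span_eq_of_two_term (hli k)
    (fun i hi => (hx i).eq_zero k hi) Function.bijective_id
    (fun i => q - i.val) (fun j => z j k) (by
      intro j
      rcases hcℓ j with ⟨h, h'⟩ | ⟨h, h'⟩
      · refine ⟨a (c j), -a (ℓ j.castSucc), c j, hαs _, ?_, ?_⟩
        · simp [Fin.lt_def] at h' ⊢
          omega
        · simp only [z, h, neg_smul, sub_eq_add_neg, id]
      · refine ⟨-a (ℓ j.castSucc), a (c j), ℓ j.castSucc, neg_ne_zero.2 (hαs _), ?_, ?_⟩
        · simp [Fin.lt_def] at h' ⊢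
          omega
        · simp only [z, h, neg_smul, sub_eq_add_neg, id]
          rw [add_comm])
  -- it suffices to compare the nonzero vectors of `y` at a vertex with a subfamily
  have htransfer : ∀ k {κ : Type} (e : κ → ((T ⊕ Unit) ⊕ Unit) ⊕ Fin q) (s : Set κ)
      (Y : κ → 𝕍.V k), Function.Injective e → LinearIndepOn F Y s →
      {i | b' i ≤ k ∧ k ≤ d' i} = e '' s → (∀ i ∈ s, y (e i) k = Y i) →
      LinearIndepOn F (fun i => y i k) {i | b' i ≤ k ∧ k ≤ d' i} ∧
        Submodule.span F (Set.range fun i => y i k) = Submodule.span F (Y '' s) := by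
    intro k κ e s Y he hY hs hyY
    constructor
    · rw [hs]
      exact LinearIndepOn.image_of_comp e _ (hY.congr fun i hi => (hyY i hi).symm)
    · rw [span_range_eq_span_image (hy0 k), hs, Set.image_image]
      exact congrArg _ (Set.image_congr hyY)
  have heL : Function.Injective
      (Sum.map Sum.inl id : (T ⊕ Unit) ⊕ Fin q → ((T ⊕ Unit) ⊕ Unit) ⊕ Fin q) :=
    Sum.inl_injective.sumMap Function.injective_id
  have heR : Function.Injective
      (Sum.map (Sum.map Sum.inl id) id : (T ⊕ Unit) ⊕ Fin q → ((T ⊕ Unit) ⊕ Unit) ⊕ Fin q) :=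
    (Sum.inl_injective.sumMap Function.injective_id).sumMap Function.injective_id
  have main : ∀ k, LinearIndepOn F (fun i => y i k) {i | b' i ≤ k ∧ k ≤ d' i} ∧
      Submodule.span F (Set.range fun i => y i k) = LinearMap.range (G.app k) := by
    intro k
    rcases lt_trichotomy k m with hk | rfl | hk
    · obtain ⟨h1, h2⟩ := hleft k
      obtain ⟨h3, h4⟩ := htransfer k _ _ _ heL h1 (by
        ext (((t | _) | _) | j)
        · simp [b', d', reindex]
        · have := hd (ℓ (Fin.last q))
          simp [b', d', reindex]
          omega
        · simp [b', d', reindex]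
          omega
        · have := hd (ℓ j.castSucc)
          have := hd j.castSucc
          simp [b', d', reindex]
          omega) (by
        rintro ((t | _) | j) hi
        · rfl
        · exact if_pos ⟨hi.1, by omega⟩
        · exact if_pos ⟨hi.1, le_trans (by omega) (hd j.castSucc)⟩)
      refine ⟨h3, ?_⟩
      rw [h4, h2, hspan, LinearMap.range_eq_top.2 (hG k hk.ne).2]
    -- at the vertex, the family of the left side loses its vector `x (inr (ℓ (last q)))`
    · obtain ⟨h1, h2⟩ := hleft k
      have hmem : (Sum.inl (Sum.inr ()) : (T ⊕ Unit) ⊕ Fin q) ∈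
          reindex ℓ ⁻¹' {i | b i ≤ k ∧ k ≤ d i} := by
        have := hb (ℓ (Fin.last q))
        have := hd (ℓ (Fin.last q))
        simp [reindex]
        omega
      obtain ⟨h3, h4⟩ := htransfer k _ _ _ heL (h1.mono (Set.sdiff_subset (t := {.inl (.inr ())})))
        (by
          ext (((t | _) | _) | j)
          · simp [b', d', reindex]
          · simp [b', d', reindex]
            omega
          · simp [b', d', reindex]
            omega
          · have := hd (ℓ j.castSucc)
            have := hd j.castSucc
            simp [b', d', reindex]
            omega) (by
        rintro ((t | _) | j) hi
        · rfl
        · exact absurd rfl hi.2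
        · exact if_pos ⟨hi.1.1, le_trans (by omega) (hd j.castSucc)⟩)
      refine ⟨h3, ?_⟩
      have hzα : ∀ j, α (z j k) = 0 := by
        intro j
        simp only [z, map_sub, map_smul, smul_eq_mul, ha]
        ring
      have hle : ∀ w ∈ Submodule.span F (Set.range fun i => y i k), α w = 0 := by
        rw [h4]
        intro w hw
        refine (Submodule.span_le (p := LinearMap.ker α)).2 ?_ hw
        rintro _ ⟨(t | _) | j, hi, rfl⟩
        · exact hαT t
        · exact absurd rfl hi.2
        · exact hzα j
      rw [hGm, hα]
      refine le_antisymm hle fun w hw => ?_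
      -- a vector of the kernel of `α` has no component along the vector that is left out
      have hw' : w ∈ Submodule.span F (Set.range fun i => x i k) := hspan k ▸ Submodule.mem_top
      rw [← h2, ← Set.insert_sdiff_self_of_mem hmem, Set.image_insert_eq,
        Submodule.mem_span_insert] at hw'
      obtain ⟨c₀, w', hw', rfl⟩ := hw'
      rw [← h4] at hw'
      have h5 : c₀ * α (x (.inr (ℓ (Fin.last q))) k) = 0 := by
        have h6 : α (c₀ • x (.inr (ℓ (Fin.last q))) k + w') = 0 := hw
        rwa [map_add, hle w' hw', add_zero, map_smul, smul_eq_mul] at h6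
      rw [(mul_eq_zero.1 h5).resolve_right (hαs _), zero_smul, zero_add]
      exact hw'
    · obtain ⟨h1, h2⟩ := hright k
      obtain ⟨h3, h4⟩ := htransfer k _ _ _ heR h1 (by
        ext (((t | _) | _) | j)
        · simp [b', d', reindex]
        · simp [b', d', reindex]
          omega
        · have := hb (Fin.last q)
          simp [b', d', reindex]
          omega
        · have := hb (ℓ j.castSucc)
          have := hb j.castSucc
          simp [b', d', reindex]
          omega) (by
        rintro ((t | _) | j) hi
        · rfl
        · exact if_pos ⟨by omega, hi.2⟩
        · exact if_pos ⟨(hb (ℓ j.castSucc)).trans (by omega), hi.2⟩)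
      refine ⟨h3, ?_⟩
      rw [h4, h2, hspan, LinearMap.range_eq_top.2 (hG k hk.ne').2]
  refine nonempty_iso_pi_interval G (fun k => ?_) y b' d' hy (fun k => (main k).1)
    fun k => (main k).2
  by_cases hk : k = m
  · subst hk
    rwa [hGm]
  · exact (hG k hk).1

end ReversedReflectionDiamond

end ZigzagModule

/-! ### Compatible bases -/

namespace ZigzagModule

variable {F : Type u} [Field F] {n : ℕ} {o : Fin n → Bool}

namespace IsCompatibleBasis

variable {M : ZigzagModule.{u, v} F o} {D : M.IntervalDecomposition} {k : Fin n} {e : ℕ}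
  {v : Module.Basis (Fin e) F (M.V k)} {att : Fin e → D.ι}

/-- Different basis vectors belong to different summands, as the summands are at most
one-dimensional at every vertex. -/
theorem injective (h : IsCompatibleBasis D v att) : Function.Injective att := by
  intro i j hij
  obtain ⟨x, -, hx, hx'⟩ := h i
  obtain ⟨y, -, hy, hy'⟩ := h j
  have h1 : v i ∈ Submodule.span F {v j} := by
    rw [← hx, ← hy, hy', ← hij, ← hx']
    exact Submodule.mem_span_singleton_self _
  obtain ⟨c, hc⟩ := Submodule.mem_span_singleton.1 h1
  by_contra hne
  have := congrArg (fun w => v.repr w i) hc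
  simp [Finsupp.single_eq_of_ne hne] at this

/-- A compatible basis consists of the components at `k` of generators of the summands. -/
theorem exists_generators (h : IsCompatibleBasis D v att) :
    ∃ x : D.ι → ∀ k, M.V k,
      (∀ t, M.IsRepresentativeSequence (x t) (D.birth t) (D.death t)) ∧
      (∀ j, x (att j) k = v j) ∧
      ∀ t k', Submodule.span F {x t k'} = Submodule.span F {D.seq t k'} := by
  have key : ∀ t, ∃ x : ∀ k, M.V k,
      M.IsRepresentativeSequence x (D.birth t) (D.death t) ∧
      (∀ j, att j = t → x k = v j) ∧
      ∀ k', Submodule.span F {x k'} = Submodule.span F {D.seq t k'} := by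
    intro t
    by_cases ht : ∃ j, att j = t
    · obtain ⟨j, rfl⟩ := ht
      obtain ⟨x, h1, h2, h3⟩ := h j
      exact ⟨x, h1, fun j' hj' => by rw [h2, h.injective hj'], h3⟩
    · exact ⟨D.seq t, D.isRep t, fun j hj => absurd ⟨j, hj⟩ ht, fun _ => rfl⟩
  choose x h1 h2 h3 using key
  exact ⟨x, h1, fun j => h2 _ j rfl, h3⟩

/-- Every summand that is nonzero at the vertex `k` contributes to a compatible basis there. -/
theorem mem_range_of_ne_zero (h : IsCompatibleBasis D v att) {t : D.ι} (ht : D.seq t k ≠ 0) :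
    t ∈ Set.range att := by
  by_contra hn
  have hle : (⊤ : Submodule F (M.V k)) ≤ ⨆ (t') (_ : t' ≠ t), Submodule.span F {D.seq t' k} := by
    rw [← v.span_eq, Submodule.span_le]
    rintro _ ⟨j, rfl⟩
    obtain ⟨x, -, hx, hx'⟩ := h j
    have hj : v j ∈ Submodule.span F {D.seq (att j) k} := by
      rw [← hx, ← hx']
      exact Submodule.mem_span_singleton_self _
    exact Submodule.mem_iSup_of_mem (att j)
      (Submodule.mem_iSup_of_mem (fun e => hn ⟨j, e⟩) hj)
  have := (D.independent k t).mono_right hle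
  rw [disjoint_top, Submodule.span_singleton_eq_bot] at this
  exact ht this

end IsCompatibleBasis

end ZigzagModule

/-- A subspace of codimension one in the kernel of a nonzero linear form is the kernel. -/
theorem Submodule.eq_ker_of_finrank_quotient_eq_one {F V : Type*} [Field F] [AddCommGroup V]
    [Module F V] [Module.Finite F V] {p : Submodule F V} (hp : Module.finrank F (V ⧸ p) = 1)
    {α : V →ₗ[F] F} (hα : α ≠ 0) (hle : p ≤ LinearMap.ker α) : p = LinearMap.ker α := by
  refine Submodule.eq_of_le_of_finrank_eq hle ?_
  have h1 := p.finrank_quotient_add_finrank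
  have h2 := α.finrank_range_add_finrank_ker
  rw [LinearMap.range_eq_top.2 (LinearMap.surjective hα), finrank_top, Module.finrank_self] at h2
  omega

/-! ### The reversed reflection diamond principle -/

theorem mainTheorem1 {F : Type u} [Field F] {n : ℕ} (o : Fin n → Bool)
    (𝕍 : ZigzagModule.{u, v} F o) (𝕎 : ZigzagModule.{u, w} F o) (l m r : Fin n)
    (Δ : ZigzagModule.ReversedReflectionDiamond 𝕍 𝕎 l m r) :
    -- 1. `g` surjective of nullity 1
    ((Function.Surjective Δ.g ∧ Module.finrank F (LinearMap.ker Δ.g) = 1) →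
      Nonempty (ZigzagModule.Iso 𝕎 (𝕍.prod (ZigzagModule.interval F o m m)))) ∧
    -- 2. `g` injective of corank 1
    ((Function.Injective Δ.g ∧ Module.finrank F (𝕍.V m ⧸ LinearMap.range Δ.g) = 1) →
      ∀ (D : 𝕍.IntervalDecomposition) (e : ℕ) (v : Module.Basis (Fin e) F (𝕍.V m))
        (att : Fin e → D.ι), ZigzagModule.IsCompatibleBasis D v att →
      -- `ξ` generates the orthogonal of the image of `g` for the form making `v` orthonormal
      ∀ ξ : 𝕍.V m, ξ ≠ 0 →
        (LinearMap.range Δ.g).orthogonalBilin v.toDual = Submodule.span F {ξ} →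
      -- `s` lists the `p = q + 1` indices with nonzero coefficient, by decreasing deaths
      ∀ (q : ℕ) (s : Fin (q + 1) ≃ {j : Fin e // v.repr ξ j ≠ 0})
        (b d : Fin (q + 1) → Fin n),
        (∀ j, b j = D.birth (att (s j))) → (∀ j, d j = D.death (att (s j))) →
        (∀ j k, j ≤ k → deathLE o (d k) (d j)) →
      (∀ j, b j ≤ l ∧ r ≤ d j) ∧
      (∃ ℓ, IsGreedyPairing (birthLE o) b ℓ) ∧
      ∀ ℓ, IsGreedyPairing (birthLE o) b ℓ →
        ∃ 𝕏 : ZigzagModule.{u, v} F o,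
          Nonempty (ZigzagModule.Iso 𝕍
            (𝕏.prod (ZigzagModule.finSum fun j : Fin (q + 1) =>
              ZigzagModule.interval F o (b j) (d j)))) ∧
          Nonempty (ZigzagModule.Iso 𝕎
            (((𝕏.prod (ZigzagModule.interval F o (b (ℓ (Fin.last q))) l)).prod
              (ZigzagModule.interval F o r (d (Fin.last q)))).prod
                (ZigzagModule.finSum fun j : Fin q =>
                  ZigzagModule.interval F o (b (ℓ j.castSucc)) (d j.castSucc))))) := by
  classical
  refine ⟨fun h => Δ.nonempty_iso_of_surjective h.1 h.2, ?_⟩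
  rintro ⟨hinj, hcork⟩ D e v att hv ξ - hperp q s b d hb hd hdle
  obtain rfl : b = fun j => D.birth (att (s j)) := funext hb
  obtain rfl : d = fun j => D.death (att (s j)) := funext hd
  have := D.fintype
  obtain ⟨x, hx, hxv, hxs⟩ := hv.exists_generators
  have hne : ∀ j, x (att j) m ≠ 0 := fun j => hxv j ▸ v.ne_zero j
  -- the identities at the diamond carry a generator from `m` to both of its neighbours
  have hends : ∀ j : Fin (q + 1), D.birth (att (s j)) ≤ l ∧ r ≤ D.death (att (s j)) := by
    intro j
    obtain ⟨h1, h2⟩ := ((hx _).ne_zero_iff m).1 (hne (s j))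
    constructor
    · refine (((hx (att (s j))).ne_zero_iff l).1 ?_).1
      rw [← (hx _).map_eq Δ.arrow_left h1 h2]
      exact fun h => hne (s j) (Δ.bijective_left.1 (h.trans (map_zero _).symm))
    · refine (((hx (att (s j))).ne_zero_iff r).1 ?_).2
      rw [← (hx _).map_eq Δ.arrow_right h1 h2]
      exact fun h => hne (s j) (Δ.bijective_right.1 (h.trans (map_zero _).symm))
  refine ⟨hends, exists_isGreedyPairing (birthLE_iff o) _, fun ℓ hℓ => ?_⟩
  -- the summands that do not occur in `ξ` are kept, and numbered before the others
  let T : Type := {t : D.ι // t ∉ Set.range fun j => att (s j)}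
  let ε : T ⊕ Fin (q + 1) → D.ι := Sum.elim Subtype.val fun j => att (s j)
  have hε : Function.Bijective ε := by
    constructor
    · refine Function.Injective.sumElim Subtype.val_injective
        (hv.injective.comp (Subtype.val_injective.comp s.injective)) ?_
      rintro ⟨t, ht⟩ j rfl
      exact ht ⟨j, rfl⟩
    · intro t
      by_cases ht : t ∈ Set.range fun j => att (s j)
      · obtain ⟨j, rfl⟩ := ht
        exact ⟨.inr j, rfl⟩
      · exact ⟨.inl ⟨t, ht⟩, rfl⟩
  have hint : ∀ i, 𝕍.IsIntervalHom (x (ε i)) (D.birth (ε i)) (D.death (ε i)) :=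
    fun i => (hx _).isIntervalHom
  have hli : ∀ k, LinearIndepOn F (fun i => x (ε i) k)
      {i | D.birth (ε i) ≤ k ∧ k ≤ D.death (ε i)} := by
    intro k
    have hind : iSupIndep fun t => Submodule.span F {x t k} := by
      simp only [hxs]
      exact D.independent k
    exact (hind.comp (hε.1.comp Subtype.val_injective)).linearIndependent _
      (fun i => Submodule.mem_span_singleton_self _)
      (fun i => ((hx _).ne_zero_iff k).2 i.2)
  have hspan : ∀ k, Submodule.span F (Set.range fun i => x (ε i) k) = ⊤ := by
    intro k
    rw [← D.iSup_eq_top k, Submodule.span_range_eq_iSup]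
    simp only [hxs]
    exact hε.2.iSup_comp fun t => Submodule.span F {D.seq t k}
  let α : 𝕍.V m →ₗ[F] F := v.toDual.flip ξ
  have hαv : ∀ j, α (v j) = v.repr ξ j := fun j => v.toDual_apply_right j ξ
  have hαs : ∀ j, α (x (ε (.inr j)) m) ≠ 0 := by
    intro j
    change α (x (att (s j)) m) ≠ 0
    rw [hxv, hαv]
    exact (s j).2
  have hαT : ∀ t, α (x (ε (.inl t)) m) = 0 := by
    rintro ⟨t, ht⟩
    change α (x t m) = 0
    by_cases h0 : x t m = 0
    · rw [h0, map_zero]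
    · have h1 : D.seq t m ≠ 0 :=
        ((D.isRep t).ne_zero_iff m).2 (((hx t).ne_zero_iff m).1 h0)
      obtain ⟨j, rfl⟩ := hv.mem_range_of_ne_zero h1
      rw [hxv, hαv]
      by_contra hj
      exact ht ⟨s.symm ⟨j, hj⟩, by simp⟩
  have hα : LinearMap.range Δ.g = LinearMap.ker α := by
    have := Module.Finite.of_basis v
    refine Submodule.eq_ker_of_finrank_quotient_eq_one hcork (fun h => hαs 0 (by simp [h])) ?_
    intro y hy
    have hξ : ξ ∈ (LinearMap.range Δ.g).orthogonalBilin v.toDual :=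
      hperp ▸ Submodule.mem_span_singleton_self ξ
    exact hξ y hy
  obtain ⟨X, ⟨eX⟩⟩ := ZigzagModule.exists_iso_pi_interval (fun t => x (ε (.inl t))) _ _
    (fun t => hint (.inl t)) fun k =>
      LinearIndepOn.comp_of_image (f := (Sum.inl : T → T ⊕ Fin (q + 1)))
        ((hli k).mono (by rintro _ ⟨t, ht, rfl⟩; exact ht)) Sum.inl_injective.injOn
  obtain ⟨eV⟩ := ZigzagModule.nonempty_iso_pi_interval
    (G := (⟨fun _ => LinearMap.id, fun _ _ => rfl⟩ : ZigzagModule.Hom 𝕍 𝕍))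
    (fun _ => Function.injective_id) (fun i => x (ε i)) _ _ hint hli
    (fun k => (hspan k).trans LinearMap.range_id.symm)
  obtain ⟨eW⟩ := Δ.nonempty_iso_of_injective hinj (fun i => x (ε i)) _ _ hint hli hspan
    (fun j => (hends j).1) (fun j => (hends j).2) hdle α hα hαT hαs hℓ
  refine ⟨X, ⟨?_⟩, ⟨?_⟩⟩
  · exact (eV.trans (ZigzagModule.piSumIso _)).trans (eX.symm.prodCongr (.refl _))
  · refine (eW.trans (ZigzagModule.piSumIso _)).trans (.prodCongr ?_ (.refl _))
    refine (ZigzagModule.piSumIso _).trans (.prodCongr ?_ (ZigzagModule.piUnitIso _))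
    exact (ZigzagModule.piSumIso _).trans (eX.symm.prodCongr (ZigzagModule.piUnitIso _))
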